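/- An overlined part is written $\overline{m}$. In a sequence of positive integers "overlining is allowed on final occurrences" means that the final occurrence of an integer in the sequence may (but need not) be overlined, and no other occurrence may be; sequences differing only in overlining are considered different. Put $\chi(\overline{\lambda_k}) = 1$ if $\lambda_k$ is overlined and $\chi(\overline{\lambda_k}) = 0$ otherwise; sizes, congruences and differences of parts ignore overlining. For integers $n,i,j\ge 0$ let $\overline{\mathcal{C}''}(n;i,j)$ denote the number of (possibly empty, not necessarily monotone) finite sequences $(\lambda_1,\dots,\lambda_s)$ of positive integers with sum $n$, with overlining allowed on final occurrences, such that - no part is congruent to $3$ modulo $4$, exactly $i$ parts are congruent to $1$ modulo $4$ and exactly $j$ parts are congruent to $2$ modulo $4$; - if $s\ge 1$, the last part $\lambda_s$ is none of $\overline{1}, 1, \overline{2}, \overline{5}$; - for every $1\le k<s$, $$ \lambda_k -\lambda_{k+1} \geq \begin{cases} -2+4 \chi(\overline{\lambda_k}) & \text{if } \lambda_k \equiv 0 \pmod 4 \text{ or } \lambda_k + \lambda_{k+1} \equiv 3 \pmod 4, \\ 4 + 4 \chi(\overline{\lambda_k}) & \text{otherwise;} \end{cases}$$ - the final $t$ parts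 $\lambda_{s-t+1},\dots,\lambda_s$ are overlined, where $t$ is the number of parts congruent to $0$ modulo $4$. Let $\overline{\mathcal{D}''}(n;i,j)$ denote the number of overpartitions of $n$ (non-increasing sequences of positive integers with sum $n$, with overlining allowed on final occurrences) in which no overlined part is congruent to $3$ modulo $4$, there is no part $\overline{1}$, every non-overlined part is congruent to $3$ modulo $8$, exactly $i$ parts are congruent to $1$ modulo $4$ or to $3$ modulo $8$, and exactly $j$ parts are congruent to $2$ modulo $4$ or to $3$ modulo $8$. Then $\overline{\mathcal{C}''}(n;i,j) = \overline{\mathcal{D}''}(n;i,j)$ for all $n,i,j\ge 0$. -/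

import Mathlib

/-- A part of a (jagged) overpartition: a natural number (its size) together with a flag telling
whether the part is overlined. -/
abbrev OPart : Type := ℕ × Bool

namespace OPart

/-- The size of a part. -/
abbrev size (x : OPart) : ℕ := x.1

/-- `x.IsOverlined` holds when the part `x` is overlined. -/
abbrev IsOverlined (x : OPart) : Prop := x.2 = true

/-- The indicator `χ`: `1` on overlined parts and `0` on non-overlined parts. -/
def chi (x : OPart) : ℤ := if x.IsOverlined then 1 else 0

/-- The minimal difference between a part `x` and the part `y` that follows it. -/
def minDiff (x y : OPart) : ℤ :=
  if x.size % 4 = 0 ∨ (x.size + y.size) % 4 = 3 then -2 + 4 * x.chi else 4 + 4 * x.chi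

end OPart

/-- The number partitioned by a sequence of parts: the sum of the sizes. -/
def weight (l : List OPart) : ℕ := (l.map OPart.size).sum

/-- Only the final occurrence of a number may be overlined: no part after an overlined part has
the same size. -/
def OnlyFinalOverlined (l : List OPart) : Prop :=
  l.Pairwise fun x y => x.IsOverlined → y.size ≠ x.size

/-- Overpartitions: non-increasing sequences of positive integers in which the final occurrence of
a number may be overlined. -/
structure IsOverpartition (l : List OPart) : Prop where
  pos : ∀ x ∈ l, 0 < x.size
  noninc : l.Pairwise fun x y => y.size ≤ x.size
  overlined : OnlyFinalOverlined l

/-- The jagged overpartitions into positive parts not congruent to `3` modulo `4` with the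
mod `4` difference conditions, and whose final `t` parts are overlined, where `t` is the number of
parts divisible by `4`. -/
structure IsJagged (l : List OPart) : Prop where
  pos : ∀ x ∈ l, 0 < x.size
  overlined : OnlyFinalOverlined l
  mod_four : ∀ x ∈ l, x.size % 4 ≠ 3
  /-- The last part, if there is one, is none of `1̄`, `1`, `2̄`, `5̄`. -/
  last : ∀ x ∈ l.getLast?, x ≠ (1, true) ∧ x ≠ (1, false) ∧ x ≠ (2, true) ∧ x ≠ (5, true)
  /-- The difference condition on every pair of consecutive parts. -/
  diff : l.IsChain fun x y => (x.size : ℤ) - (y.size : ℤ) ≥ x.minDiff y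
  /-- The final `t` parts are overlined. -/
  final : ∀ x ∈ l.drop (l.length - l.countP fun y => y.size % 4 = 0), x.IsOverlined

/-- The overpartitions whose overlined parts are not congruent to `3` modulo `4`, with no part `1̄`,
and whose non-overlined parts are congruent to `3` modulo `8`. -/
structure IsRestrictedOver (l : List OPart) : Prop where
  isOverpartition : IsOverpartition l
  overlined_mod : ∀ x ∈ l, x.IsOverlined → x.size % 4 ≠ 3
  no_one : ((1, true) : OPart) ∉ l
  nonoverlined_mod : ∀ x ∈ l, ¬ x.IsOverlined → x.size % 8 = 3

/-- The jagged overpartitions of `n` with `i` parts congruent to `1` and `j` parts congruent to `2`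
modulo `4`. -/
def jaggedSet (n i j : ℕ) : Set (List OPart) :=
  {l | IsJagged l ∧ weight l = n ∧
    (l.countP fun x => x.size % 4 = 1) = i ∧ (l.countP fun x => x.size % 4 = 2) = j}

/-- The restricted overpartitions of `n` with `i` parts congruent to `1` modulo `4` or `3` modulo
`8`, and `j` parts congruent to `2` modulo `4` or `3` modulo `8`. -/
def restrictedOverSet (n i j : ℕ) : Set (List OPart) :=
  {l | IsRestrictedOver l ∧ weight l = n ∧
    (l.countP fun x => x.size % 4 = 1 ∨ x.size % 8 = 3) = i ∧
    (l.countP fun x => x.size % 4 = 2 ∨ x.size % 8 = 3) = j}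

/-- There are finitely many sequences of positive parts of given weight, so that the cardinalities
of the sets defined above are genuine counts. -/
theorem finite_weight_eq (n : ℕ) :
    {l : List OPart | (∀ x ∈ l, 0 < x.size) ∧ weight l = n}.Finite := by
  have hfin := (List.finite_length_le (Fin (n + 1) × Bool) n).image
    (List.map fun p => ((p.1 : ℕ), p.2))
  refine hfin.subset ?_
  rintro l ⟨hpos, hw⟩
  have hle : ∀ x ∈ l, x.1 < n + 1 := fun x hx => by
    have h := List.single_le_sum (l := l.map OPart.size) (fun _ _ => Nat.zero_le _) x.1
      (List.mem_map_of_mem hx)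
    have h' : (l.map OPart.size).sum = n := hw
    have h'' : x.1 ≤ (l.map OPart.size).sum := h
    omega
  have hlen : l.length ≤ n := by
    have h := List.length_le_sum_of_one_le (l.map OPart.size) (by
      intro k hk
      obtain ⟨x, hx, rfl⟩ := List.mem_map.1 hk
      exact hpos x hx)
    rw [List.length_map] at h
    exact h.trans hw.le
  refine ⟨l.pmap (fun x hx => ((⟨x.1, hx⟩ : Fin (n + 1)), x.2)) hle, ?_, ?_⟩
  · simpa using hlen
  · rw [List.map_pmap]
    simp

theorem jaggedSet_finite (n i j : ℕ) : (jaggedSet n i j).Finite :=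
  (finite_weight_eq n).subset fun _ h => ⟨h.1.pos, h.2.1⟩

theorem restrictedOverSet_finite (n i j : ℕ) : (restrictedOverSet n i j).Finite :=
  (finite_weight_eq n).subset fun _ h => ⟨h.1.isOverpartition.pos, h.2.1⟩

/-- The number of jagged overpartitions in `jaggedSet n i j`. -/
noncomputable def jaggedCount (n i j : ℕ) : ℕ := (jaggedSet n i j).ncard

/-- The number of overpartitions in `restrictedOverSet n i j`. -/
noncomputable def restrictedOverCount (n i j : ℕ) : ℕ := (restrictedOverSet n i j).ncard

/-! Both sides count pairs `(M, T)`, where `T` is a finite set of positive integers and `M` is a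
multiset of positive integers not congruent to 3 modulo 4 in which no even number repeats.

On the jagged side, subtract from each part 4 times the number of overlined parts at its place or
later (`lower`). The terms 4χ leave the difference conditions, and an overline at position p costs
4p in weight, whichever part carries it (`bijOn_raise`, `overStat_raise`). The remaining sizes are
encoded by keys (`bijOn_expand`): a part 4m+1 directly followed by 4m+2 shares with it the key 4m+1,
while 4m, 4m+1, 4m+2 standing alone have keys 4m+3, 4m, 4m+2. The gaps then say that keys are
non-increasing and even keys do not repeat; a last part different from 1 means that 0 is not a key.

Let s parts be indivisible and t parts divisible by 4. The overlines on the first s places are free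
and form a subset of {1, …, s}; those on the last t places are forced and cost 4((s+1) + … + (s+t)).
The keys 4m+3 repeat freely, so the t values m form an arbitrary non-increasing list; adding s+t, …,
s+1 to it gives an arbitrary set of t integers greater than s. Both sets together are `T`, of total
cost 4ΣT (`bijOn_splitSet`, `keysStat_insertTight_splitSet`).

On the overpartition side, `T` gives the overlined multiples of 4, the even keys 4m and 4m+2 give
the overlined parts 4m+1 and 4m+2, and the repeatable key 4m+1 gives the non-overlined part 8m+3 =
(4m+1) + (4m+2), which counts for both i and j (`bijOn_codes`). -/

namespace JaggedOverpartition

/-! ### Removing the overlines from the difference conditions -/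

/-- The difference condition between consecutive sizes of non-overlined parts. -/
def Gap (x y : ℕ) : Prop :=
  (x : ℤ) - y ≥ if x % 4 = 0 ∨ (x + y) % 4 = 3 then -2 else 4

/-- The number of overlined parts. -/
def overlines (l : List OPart) : ℕ := l.countP fun x => x.2

/-- Add `4` to a part for each overlined part at its position or later. -/
def raise : List OPart → List OPart
  | [] => []
  | x :: l => (x.1 + 4 * overlines (x :: l), x.2) :: raise l

/-- Subtract `4` from a part for each overlined part at its position or later. -/
def lower : List OPart → List OPart
  | [] => []
  | x :: l => (x.1 - 4 * overlines (x :: l), x.2) :: lower l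

theorem overlines_cons (x : OPart) (l : List OPart) :
    overlines (x :: l) = (if x.2 then 1 else 0) + overlines l := by
  simp [overlines, List.countP_cons, add_comm]

theorem map_snd_raise (l : List OPart) : (raise l).map Prod.snd = l.map Prod.snd := by
  induction l with
  | nil => rfl
  | cons x l ih => simp [raise, ih]

theorem map_snd_lower (l : List OPart) : (lower l).map Prod.snd = l.map Prod.snd := by
  induction l with
  | nil => rfl
  | cons x l ih => simp [lower, ih]

theorem overlines_eq (l : List OPart) : overlines l = (l.map Prod.snd).countP id := by
  simp [overlines, List.countP_map]

theorem overlines_raise (l : List OPart) : overlines (raise l) = overlines l := by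
  rw [overlines_eq, overlines_eq, map_snd_raise]

theorem overlines_lower (l : List OPart) : overlines (lower l) = overlines l := by
  rw [overlines_eq, overlines_eq, map_snd_lower]

theorem lower_raise (l : List OPart) : lower (raise l) = l := by
  induction l with
  | nil => rfl
  | cons x l ih =>
    have h : overlines ((x.1 + 4 * overlines (x :: l), x.2) :: raise l) = overlines (x :: l) := by
      rw [overlines_cons, overlines_cons, overlines_raise]
    simp only [raise, lower, ih, h]
    simp

theorem map_mod_raise (l : List OPart) :
    (raise l).map (fun x => x.1 % 4) = l.map fun x => x.1 % 4 := by
  induction l with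
  | nil => rfl
  | cons x l ih => simp [raise, ih]

theorem countP_mod_raise (l : List OPart) (c : ℕ) :
    (raise l).countP (fun x => x.1 % 4 = c) = l.countP fun x => x.1 % 4 = c := by
  have h := congrArg (List.countP fun a => decide (a = c)) (map_mod_raise l)
  simpa [List.countP_map, Function.comp_def] using h

/-- The final `t` parts are overlined, where `t` is the number of parts divisible by `4`. -/
def FinalOverlined (l : List OPart) : Prop :=
  ∀ x ∈ l.drop (l.length - l.countP fun y => y.1 % 4 = 0), x.2 = true

theorem finalOverlined_iff (l : List OPart) :
    FinalOverlined l ↔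
      ∀ b ∈ (l.map Prod.snd).drop ((l.map Prod.snd).length - l.countP fun y => y.1 % 4 = 0),
        b = true := by
  rw [← List.map_drop]
  simp only [FinalOverlined, List.mem_map, List.length_map]
  constructor
  · rintro h b ⟨x, hx, rfl⟩
    exact h x hx
  · intro h x hx
    exact h _ ⟨x, hx, rfl⟩

theorem finalOverlined_raise (l : List OPart) : FinalOverlined (raise l) ↔ FinalOverlined l := by
  rw [finalOverlined_iff, finalOverlined_iff, map_snd_raise, countP_mod_raise]

/-- Raising increases a consecutive difference by 4 exactly when its first part is overlined, which
is the term 4χ in `minDiff`; residues modulo 4, hence the two cases, are unchanged. -/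
theorem isChain_raise (l : List OPart) :
    (raise l).IsChain (fun x y => (x.size : ℤ) - (y.size : ℤ) ≥ x.minDiff y) ↔
      l.IsChain fun x y => Gap x.1 y.1 := by
  induction l with
  | nil => simp [raise]
  | cons x l ih =>
    cases l with
    | nil => simp [raise]
    | cons y l =>
      have h : raise (x :: y :: l) = (x.1 + 4 * overlines (x :: y :: l), x.2) ::
        (y.1 + 4 * overlines (y :: l), y.2) :: raise l := rfl
      rw [h, List.isChain_cons_cons, List.isChain_cons_cons, ← ih]
      refine and_congr ?_ Iff.rfl
      obtain ⟨a, b⟩ := x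
      simp only [Gap, OPart.minDiff, OPart.size, OPart.chi, OPart.IsOverlined]
      rw [overlines_cons]
      generalize overlines (y :: l) = k
      obtain ⟨c, d⟩ := y
      have e1 : ∀ m, (a + 4 * m) % 4 = a % 4 := by omega
      have e2 : ∀ m, (a + 4 * m + (c + 4 * k)) % 4 = (a + c) % 4 := by omega
      simp only [e1, e2]
      cases b <;> simp <;> split_ifs <;> constructor <;> intro h <;> linarith

/-- Lists of sizes, with overlines not counted in the sizes, that `raise` maps to jagged
overpartitions. -/
structure IsFlagged (l : List OPart) : Prop where
  mod_four : ∀ x ∈ l, x.1 % 4 ≠ 3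
  last : ∀ x ∈ l.getLast?, x.1 ≠ 1
  diff : l.IsChain fun x y => Gap x.1 y.1
  final : FinalOverlined l

theorem eq_append_overlined_of_final {l : List OPart} (hl : FinalOverlined l) {x : OPart} (hx : x ∈ l)
    (h0 : x.1 % 4 = 0) : ∃ l' b, l = l' ++ [(b, true)] := by
  obtain ⟨l', y, rfl⟩ := (List.eq_nil_or_concat' l).resolve_left (List.ne_nil_of_mem hx)
  have hpos : 0 < (l' ++ [y]).countP fun y => y.1 % 4 = 0 :=
    List.countP_pos_iff.2 ⟨x, by simpa using hx, by simpa using h0⟩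
  have := hl y (by
    rw [List.drop_append_of_le_length (by
      simp only [List.length_append, List.length_singleton]; omega)]
    simp)
  exact ⟨l', y.1, by rw [← this]⟩

/-- An overlined last part raises every part, so size 0 is harmless before raising. -/
theorem pos_of_mem_raise {l : List OPart} (h : ∀ x ∈ l, x.1 = 0 → ∃ l' b, l = l' ++ [(b, true)]) :
    ∀ x ∈ raise l, 0 < x.1 := by
  induction l with
  | nil => simp [raise]
  | cons x l ih =>
    intro y hy
    simp only [raise, List.mem_cons] at hy
    rcases hy with rfl | hy
    · by_contra hc
      simp only [not_lt, Nat.le_zero, Nat.add_eq_zero_iff] at hc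
      obtain ⟨l', b, hb⟩ := h x (by simp) hc.1
      rw [hb] at hc
      simp [overlines] at hc
    · refine ih (fun z hz hz0 => ?_) y hy
      obtain ⟨l', b, hb⟩ := h z (by simp [hz]) hz0
      cases l' with
      | nil => simp at hb; simp [hb] at hz
      | cons w l' => simp at hb; exact ⟨l', b, hb.2⟩

theorem getLast?_raise (l : List OPart) :
    (raise l).getLast? = l.getLast?.map fun x => (x.1 + if x.2 then 4 else 0, x.2) := by
  induction l with
  | nil => rfl
  | cons x l ih =>
    cases l with
    | nil => cases h : x.2 <;> simp [raise, overlines, h]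
    | cons y l =>
      have h : raise (x :: y :: l) = (x.1 + 4 * overlines (x :: y :: l), x.2) ::
        (y.1 + 4 * overlines (y :: l), y.2) :: raise l := rfl
      rw [h, List.getLast?_cons_cons, List.getLast?_cons_cons, ← ih]
      rfl

/-- Without residue 3, a rise of at most 2 from residue 0, or between residues 1 and 2, stays within
the block 4m, 4m+1, 4m+2; an overline shifts the bound by a whole block. -/
theorem isChain_div {l : List OPart} (hmod : ∀ x ∈ l, x.1 % 4 ≠ 3)
    (h : l.IsChain (fun x y => (x.size : ℤ) - (y.size : ℤ) ≥ x.minDiff y)) :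
    l.IsChain fun x y => y.1 / 4 + (if x.2 then 1 else 0) ≤ x.1 / 4 := by
  induction l with
  | nil => simp
  | cons x l ih =>
    cases l with
    | nil => simp
    | cons y l =>
      rw [List.isChain_cons_cons] at h ⊢
      refine ⟨?_, ih (fun z hz => hmod z (by simp [hz])) h.2⟩
      have h1 := h.1
      have hx := hmod x (by simp)
      have hy := hmod y (by simp)
      simp only [OPart.minDiff, OPart.size, OPart.chi, OPart.IsOverlined] at h1
      cases hb : x.2 <;> simp [hb] at h1 ⊢ <;> split_ifs at h1 <;> omega

theorem onlyFinalOverlined_of_diff {l : List OPart} (hmod : ∀ x ∈ l, x.1 % 4 ≠ 3)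
    (h : l.IsChain (fun x y => (x.size : ℤ) - (y.size : ℤ) ≥ x.minDiff y)) :
    OnlyFinalOverlined l := by
  let R : OPart → OPart → Prop := fun x y => y.1 / 4 + (if x.2 then 1 else 0) ≤ x.1 / 4
  have : Trans R R R := ⟨fun {a b c} h1 h2 => by simp only [R] at *; omega⟩
  have h2 : l.Pairwise R := (List.isChain_iff_pairwise (R := R)).1 (isChain_div hmod h)
  refine h2.imp fun {x y} hxy hx => ?_
  simp only [R, OPart.IsOverlined] at hxy hx
  simp only [hx, if_true] at hxy
  intro he
  simp only [OPart.size] at he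
  omega

theorem isJagged_raise {l : List OPart} (h : IsFlagged l) : IsJagged (raise l) := by
  have hmod : ∀ x ∈ raise l, x.1 % 4 ≠ 3 := by
    intro x hx h3
    have := List.mem_map_of_mem (f := fun x : OPart => x.1 % 4) hx
    rw [map_mod_raise] at this
    obtain ⟨y, hy, hyx⟩ := List.mem_map.1 this
    exact h.mod_four y hy (hyx.trans h3)
  have hdiff := (isChain_raise l).2 h.diff
  refine ⟨?_, onlyFinalOverlined_of_diff hmod hdiff, hmod, ?_, hdiff,
    (finalOverlined_raise l).2 h.final⟩
  · exact pos_of_mem_raise fun x hx h0 => eq_append_overlined_of_final h.final hx (by simp [h0])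
  · intro x hx
    rw [getLast?_raise] at hx
    obtain ⟨⟨a, b⟩, hy, rfl⟩ := Option.map_eq_some_iff.1 hx
    -- An overlined last part is at least 4 after raising; both 1 and an overlined 5 would come from
    -- a size 1.
    have := h.last _ hy
    cases b <;> simp at this ⊢ <;> omega

/-- Each overline costs one in the quotient by 4, and an overlined last part is at least 4. Hence
the subtraction in `lower` never truncates. -/
theorem four_mul_overlines_le {l : List OPart} {x : OPart} (hmod : ∀ y ∈ x :: l, y.1 % 4 ≠ 3)
    (hlast : ∀ y ∈ (x :: l).getLast?, y ≠ (1, true) ∧ y ≠ (2, true)) (hpos : ∀ y ∈ x :: l, 0 < y.1)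
    (h : (x :: l).IsChain (fun x y => (x.size : ℤ) - (y.size : ℤ) ≥ x.minDiff y)) :
    overlines (x :: l) ≤ x.1 / 4 := by
  have hc := isChain_div hmod h
  clear h
  induction l generalizing x with
  | nil =>
    obtain ⟨a, b⟩ := x
    cases b
    · simp [overlines]
    · simp [overlines] at hlast hmod hpos ⊢
      omega
  | cons y l ih =>
    rw [List.isChain_cons_cons] at hc
    rw [overlines_cons]
    have := ih (fun z hz => hmod z (by simp [hz])) (by simpa [List.getLast?_cons_cons] using hlast)
      (fun z hz => hpos z (by simp [hz])) hc.2
    have := hc.1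
    omega

theorem raise_lower {l : List OPart} (h : IsJagged l) : raise (lower l) = l := by
  have hlast : ∀ y ∈ l.getLast?, y ≠ (1, true) ∧ y ≠ (2, true) := fun y hy =>
    ⟨(h.last y hy).1, (h.last y hy).2.2.1⟩
  have hmod := h.mod_four
  have hpos := h.pos
  have hdiff := h.diff
  clear h
  induction l with
  | nil => rfl
  | cons x l ih =>
    have hle := four_mul_overlines_le hmod hlast hpos hdiff
    have ih := ih (by
        cases l with
        | nil => simp
        | cons y l => simpa [List.getLast?_cons_cons] using hlast)
      (fun z hz => hmod z (by simp [hz])) (fun z hz => hpos z (by simp [hz]))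
      (List.isChain_cons.1 hdiff).2
    have e : overlines ((x.1 - 4 * overlines (x :: l), x.2) :: lower l) = overlines (x :: l) := by
      rw [overlines_cons, overlines_cons, overlines_lower]
    simp only [lower, raise, ih, e]
    rw [Nat.sub_add_cancel (by omega)]

theorem isFlagged_lower {l : List OPart} (h : IsJagged l) : IsFlagged (lower l) := by
  have e := raise_lower h
  refine ⟨?_, ?_, ?_, ?_⟩
  · intro x hx h3
    have := List.mem_map_of_mem (f := fun x : OPart => x.1 % 4) hx
    rw [← map_mod_raise, e] at this
    obtain ⟨y, hy, hyx⟩ := List.mem_map.1 this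
    exact h.mod_four y hy (hyx.trans h3)
  · intro x hx h1
    have := h.last (x.1 + if x.2 then 4 else 0, x.2) (by
      nth_rw 1 [← e]
      rw [getLast?_raise, Option.mem_def.1 hx]
      rfl)
    obtain ⟨a, b⟩ := x
    simp only at h1
    subst h1
    cases b <;> simp at this
  · rw [← isChain_raise, e]
    exact h.diff
  · rw [← finalOverlined_raise, e]
    exact h.final

theorem bijOn_raise : Set.BijOn raise {l | IsFlagged l} {l | IsJagged l} :=
  Set.InvOn.bijOn (f' := lower) ⟨fun l _ => lower_raise l, fun _ h => raise_lower h⟩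
    (fun _ h => isJagged_raise h) fun _ h => isFlagged_lower h

/-! ### Encoding sizes by keys -/

/-- The order on keys: non-increasing, and strictly decreasing after an even key. -/
def KeyLe (x y : ℕ) : Prop := y ≤ x ∧ (x % 2 = 0 → y < x)

instance : Trans KeyLe KeyLe KeyLe :=
  ⟨fun {a b c} h1 h2 => by simp only [KeyLe] at *; omega⟩

/-- The key of a part standing alone. -/
def token (x : ℕ) : ℕ := if x % 4 = 0 then x + 3 else if x % 4 = 1 then x - 1 else x

/-- The parts encoded by a key. -/
def partsOf (k : ℕ) : List ℕ :=
  if k % 4 = 0 then [k + 1] else if k % 4 = 1 then [k, k + 1] else if k % 4 = 2 then [k] else [k - 3]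

/-- The parts encoded by a list of keys. -/
def expand (τ : List ℕ) : List ℕ := τ.flatMap partsOf

/-- The list of keys encoding a list of parts: a part `4 * m + 1` followed by `4 * m + 2` is
encoded by a single key. -/
def parse : List ℕ → List ℕ
  | [] => []
  | [x] => [token x]
  | x :: y :: l => if x % 4 = 1 ∧ y = x + 1 then x :: parse l else token x :: parse (y :: l)

/-- The lists of sizes of parts of flagged lists. -/
structure IsPlain (r : List ℕ) : Prop where
  mod_four : ∀ x ∈ r, x % 4 ≠ 3
  last : ∀ x ∈ r.getLast?, x ≠ 1
  diff : r.IsChain Gap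

/-- The lists of keys of plain lists. -/
structure IsKeyList (τ : List ℕ) : Prop where
  chain : τ.IsChain KeyLe
  ne_zero : 0 ∉ τ

theorem partsOf_token {x : ℕ} (hx : x % 4 ≠ 3) : partsOf (token x) = [x] := by
  have : x % 4 = 0 ∨ x % 4 = 1 ∨ x % 4 = 2 := by omega
  rcases this with h | h | h
  · simp [token, partsOf, h, show (x + 3) % 4 = 3 by omega]
  · simp [token, partsOf, h, show (x - 1) % 4 = 0 by omega]
    omega
  · simp [token, partsOf, h]

theorem expand_cons (k : ℕ) (τ : List ℕ) : expand (k :: τ) = partsOf k ++ expand τ := rfl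

theorem expand_parse {r : List ℕ} (h : ∀ x ∈ r, x % 4 ≠ 3) : expand (parse r) = r := by
  induction r using parse.induct with
  | case1 => rfl
  | case2 x => simp [parse, expand, partsOf_token (h x (by simp))]
  | case3 x y l hxy ih =>
    rw [parse, if_pos hxy, expand_cons, ih fun z hz => h z (by simp [hz])]
    simp [partsOf, hxy]
  | case4 x y l hxy ih =>
    rw [parse, if_neg hxy, expand_cons, ih fun z hz => h z (by simp_all),
      partsOf_token (h x (by simp))]
    rfl

theorem parse_cons_of_head {x : ℕ} {l : List ℕ} (h : ∀ y ∈ l.head?, ¬ (x % 4 = 1 ∧ y = x + 1)) :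
    parse (x :: l) = token x :: parse l := by
  cases l with
  | nil => rfl
  | cons y l => rw [parse, if_neg (h y (by simp))]

theorem head?_expand (τ : List ℕ) : ∀ y ∈ (expand τ).head?, ∃ k ∈ τ.head?,
    y = if k % 4 = 0 then k + 1 else if k % 4 = 3 then k - 3 else k := by
  cases τ with
  | nil => simp [expand]
  | cons k τ =>
    intro y hy
    refine ⟨k, by simp, ?_⟩
    rw [expand_cons] at hy
    unfold partsOf at hy
    split_ifs at hy ⊢ <;> simp at hy <;> omega

theorem parse_expand {τ : List ℕ} (h : τ.IsChain KeyLe) : parse (expand τ) = τ := by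
  induction τ with
  | nil => rfl
  | cons k τ ih =>
    obtain ⟨h1, h2⟩ := List.isChain_cons.1 h
    have ih := ih h2
    rw [expand_cons]
    by_cases hk : k % 4 = 1
    · simp [partsOf, hk, parse, ih]
    -- `parse` could only go wrong by merging a lone 4m+1 with a following 4m+2. A lone 4m+1 has the
    -- even key 4m, so the next key is smaller and its first part is not 4m+2.
    · have key : ∃ x, partsOf k = [x] ∧ token x = k ∧ (x % 4 = 1 → x = k + 1 ∧ k % 4 = 0) := by
        unfold partsOf token
        split_ifs
        · refine ⟨_, rfl, ?_, ?_⟩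
          · rw [if_neg (by omega), if_pos (by omega)]; omega
          · omega
        · refine ⟨_, rfl, ?_, ?_⟩
          · rw [if_neg (by omega), if_neg (by omega)]
          · omega
        · refine ⟨_, rfl, ?_, ?_⟩
          · rw [if_pos (by omega)]; omega
          · omega
      obtain ⟨x, hx, hxk, hx1⟩ := key
      rw [hx, List.singleton_append, parse_cons_of_head, hxk, ih]
      rintro y hy ⟨hx2, rfl⟩
      obtain ⟨k', hk', e⟩ := head?_expand τ _ hy
      have := h1 k' hk'
      have := hx1 hx2
      simp only [KeyLe] at *
      split_ifs at e <;> omega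

theorem getLast?_partsOf (k : ℕ) : ∃ y, (partsOf k).getLast? = some y ∧
    y = if k % 4 = 3 then k - 3 else if k % 4 = 2 then k else k + 1 := by
  unfold partsOf
  split_ifs <;> simp_all <;> omega

theorem isPlain_expand {τ : List ℕ} (h : IsKeyList τ) : IsPlain (expand τ) := by
  obtain ⟨h, h0⟩ := h
  refine ⟨?_, ?_, ?_⟩
  · intro x hx
    obtain ⟨k, -, hk⟩ := List.mem_flatMap.1 hx
    unfold partsOf at hk
    split_ifs at hk <;> simp at hk <;> omega
  · induction τ with
    | nil => simp [expand]
    | cons k τ ih =>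
      intro x hx
      rw [expand_cons, List.getLast?_append] at hx
      rcases hl : (expand τ).getLast? with _ | z
      · rw [hl] at hx
        obtain ⟨y, hy, hyk⟩ := getLast?_partsOf k
        simp only [hy, Option.none_or, Option.mem_def, Option.some.injEq] at hx
        -- Only the key 0 has 1 as its last part.
        have : k ≠ 0 := fun h => h0 (by simp [h])
        subst hx
        split_ifs at hyk <;> omega
      · rw [hl] at hx
        refine ih (List.isChain_cons.1 h).2 (fun h => h0 (by simp [h])) x ?_
        rw [hl]
        exact hx
  · induction τ with
    | nil => simp [expand]
    | cons k τ ih =>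
      obtain ⟨h1, h2⟩ := List.isChain_cons.1 h
      rw [expand_cons, List.isChain_append]
      refine ⟨?_, ih h2 fun h => h0 (by simp [h]), ?_⟩
      · unfold partsOf
        split_ifs <;> simp
        rw [Gap, if_pos (by omega)]
        push_cast
        omega
      · intro x hx y hy
        obtain ⟨y', hy', e'⟩ := getLast?_partsOf k
        obtain ⟨k', hk', e⟩ := head?_expand τ _ hy
        have := h1 k' hk'
        simp only [hy', Option.mem_def, Option.some.injEq] at hx
        subst hx
        simp only [KeyLe, Gap] at *
        split_ifs <;> split_ifs at e <;> split_ifs at e' <;> omega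

theorem head?_parse (r : List ℕ) : ∀ k ∈ (parse r).head?, ∃ x ∈ r.head?,
    k = token x ∨ (x % 4 = 1 ∧ k = x) := by
  induction r using parse.induct with
  | case1 => simp [parse]
  | case2 x => simp [parse]
  | case3 x y l hxy ih => simp [parse, hxy]
  | case4 x y l hxy ih => rw [parse, if_neg hxy]; simp

theorem isKeyList_parse {r : List ℕ} (h : IsPlain r) : IsKeyList (parse r) := by
  obtain ⟨hmod, hlast, h⟩ := h
  induction r using parse.induct with
  | case1 => exact ⟨by simp [parse], by simp [parse]⟩
  | case2 x =>
    refine ⟨by simp [parse], ?_⟩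
    simp only [parse, token, List.mem_singleton] at hlast hmod ⊢
    have := hlast x (by simp)
    intro h0
    split_ifs at h0 <;> omega
  | case3 x y l hxy ih =>
    obtain ⟨h1, h2⟩ := List.isChain_cons.1 h
    obtain ⟨h3, h4⟩ := List.isChain_cons.1 h2
    have ih := ih (fun z hz => hmod z (by simp [hz])) (by
      cases l with
      | nil => simp
      | cons z l => simpa [List.getLast?_cons_cons] using hlast) h4
    rw [parse, if_pos hxy]
    refine ⟨List.isChain_cons.2 ⟨?_, ih.chain⟩, ?_⟩
    · intro k hk
      obtain ⟨z, hz, hzk⟩ := head?_parse l k hk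
      have h3 := h3 z hz
      have h5 : z % 4 ≠ 3 := hmod z (by simp [List.mem_of_mem_head? hz])
      simp only [token, KeyLe, Gap] at *
      split_ifs at h3 hzk <;> omega
    · simp only [List.mem_cons, not_or]
      exact ⟨by omega, ih.ne_zero⟩
  | case4 x y l hxy ih =>
    obtain ⟨h1, h2⟩ := List.isChain_cons.1 h
    have ih := ih (fun z hz => hmod z (by simp_all)) (by
      simpa [List.getLast?_cons_cons] using hlast) h2
    have h1 := h1 y (by simp)
    have hx : x % 4 ≠ 3 := hmod x (by simp)
    have hy : y % 4 ≠ 3 := hmod y (by simp)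
    rw [parse, if_neg hxy]
    refine ⟨List.isChain_cons.2 ⟨?_, ih.chain⟩, ?_⟩
    · intro k hk
      obtain ⟨z, hz, hzk⟩ := head?_parse _ k hk
      simp only [List.head?_cons, Option.mem_def, Option.some.injEq] at hz
      subst hz
      simp only [token, KeyLe, Gap] at *
      split_ifs at h1 hzk ⊢ <;> omega
    · simp only [List.mem_cons, not_or]
      -- Key 0 would need x = 1; the gap allows only 2 after 1, and those two share a key.
      refine ⟨?_, ih.ne_zero⟩
      simp only [token, Gap] at *
      intro h0
      split_ifs at h1 h0 <;> omega

theorem bijOn_expand : Set.BijOn expand {τ | IsKeyList τ} {r | IsPlain r} :=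
  Set.InvOn.bijOn (f' := parse)
    ⟨fun _ h => parse_expand h.chain, fun _ h => expand_parse h.mod_four⟩
    (fun _ h => isPlain_expand h) fun _ h => isKeyList_parse h

/-! ### Statistics, and separation of flags from sizes -/

theorem ncard_eq_of_bijOn {α β γ : Type*} {f : α → β} {A : Set α} {B : Set β}
    (h : Set.BijOn f A B) (sA : α → γ) (sB : β → γ) (hs : ∀ a ∈ A, sB (f a) = sA a) (v : γ) :
    {a | a ∈ A ∧ sA a = v}.ncard = {b | b ∈ B ∧ sB b = v}.ncard := by
  have himg : f '' {a | a ∈ A ∧ sA a = v} = {b | b ∈ B ∧ sB b = v} := by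
    ext b
    constructor
    · rintro ⟨a, ⟨ha, hv⟩, rfl⟩
      exact ⟨h.mapsTo ha, (hs a ha).trans hv⟩
    · rintro ⟨hb, hv⟩
      obtain ⟨a, ha, rfl⟩ := h.surjOn hb
      exact ⟨a, ⟨ha, (hs a ha).symm.trans hv⟩, rfl⟩
  rw [← himg, Set.InjOn.ncard_image]
  exact h.injOn.mono fun a ha => ha.1

/-- The size of a part, and the indicators of its being congruent to `1` and to `2` modulo `4`. -/
def partStat (x : ℕ) : ℕ × ℕ × ℕ := (x, if x % 4 = 1 then 1 else 0, if x % 4 = 2 then 1 else 0)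

/-- The sum of the positions of the overlines. -/
def positionSum : List Bool → ℕ
  | [] => 0
  | b :: β => (b :: β).countP id + positionSum β

/-- An overline is counted once from each place up to its own, so it contributes its position,
starting from 1. -/
theorem positionSum_append (β : List Bool) (b : Bool) :
    positionSum (β ++ [b]) = positionSum β + if b then β.length + 1 else 0 := by
  induction β with
  | nil => cases b <;> rfl
  | cons c β ih =>
    simp only [List.cons_append, positionSum, ih, List.countP_cons, List.countP_append,
      List.countP_nil, List.length_cons]
    cases b <;> simp <;> omega

theorem positionSum_append_replicate (β : List Bool) (t : ℕ) :
    positionSum (β ++ List.replicate t true) =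
      positionSum β + ∑ i ∈ Finset.range t, (β.length + i + 1) := by
  induction t with
  | zero => simp
  | succ t ih =>
    rw [List.replicate_succ', ← List.append_assoc, positionSum_append, ih, Finset.sum_range_succ]
    simp [add_assoc]

/-- The statistics of a list of parts. -/
def overStat (l : List OPart) : ℕ × ℕ × ℕ := (l.map fun x => partStat x.1).sum

theorem overStat_eq (l : List OPart) :
    overStat l = (weight l, (l.countP fun x => x.size % 4 = 1), l.countP fun x => x.size % 4 = 2) := by
  induction l with
  | nil => rfl
  | cons x l ih =>
    simp only [overStat, weight, List.map_cons, List.sum_cons, List.countP_cons] at ih ⊢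
    rw [ih]
    simp [partStat, add_comm]

theorem overStat_raise (l : List OPart) :
    overStat (raise l) = overStat l + (4 * positionSum (l.map Prod.snd), 0, 0) := by
  induction l with
  | nil => rfl
  | cons x l ih =>
    simp only [overStat, raise, List.map_cons, List.sum_cons, positionSum] at ih ⊢
    rw [ih, overlines_eq]
    simp only [partStat, List.map_cons, Nat.add_mul_mod_self_left]
    ext <;> simp <;> ring

/-- The number of parts not divisible by `4`. -/
def looseLength (r : List ℕ) : ℕ := r.countP fun x => x % 4 ≠ 0

/-- The number of parts divisible by `4`. -/
def tightLength (r : List ℕ) : ℕ := r.countP fun x => x % 4 = 0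

theorem looseLength_add_tightLength (r : List ℕ) : looseLength r + tightLength r = r.length := by
  induction r with
  | nil => rfl
  | cons x r ih =>
    simp only [looseLength, tightLength, List.countP_cons, List.length_cons] at ih ⊢
    by_cases h : x % 4 = 0 <;> simp [h] <;> simp at ih <;> omega

/-- Overline the parts according to the given flags, and the final parts. -/
def zipFlags (p : List ℕ × List Bool) : List OPart :=
  p.1.zip (p.2 ++ List.replicate (tightLength p.1) true)

theorem map_fst_zipFlags {p : List ℕ × List Bool} (h : p.2.length = looseLength p.1) :
    (zipFlags p).map Prod.fst = p.1 :=
  List.map_fst_zip (by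
    rw [List.length_append, List.length_replicate, h, looseLength_add_tightLength])

theorem map_snd_zipFlags {p : List ℕ × List Bool} (h : p.2.length = looseLength p.1) :
    (zipFlags p).map Prod.snd = p.2 ++ List.replicate (tightLength p.1) true :=
  List.map_snd_zip (by
    rw [List.length_append, List.length_replicate, h, looseLength_add_tightLength])

theorem isFlagged_iff (l : List OPart) :
    IsFlagged l ↔ IsPlain (l.map Prod.fst) ∧ FinalOverlined l := by
  constructor
  · rintro ⟨h1, h2, h3, h4⟩
    refine ⟨⟨?_, ?_, ?_⟩, h4⟩
    · intro x hx
      obtain ⟨y, hy, rfl⟩ := List.mem_map.1 hx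
      exact h1 y hy
    · intro x hx
      rw [List.getLast?_map] at hx
      obtain ⟨y, hy, rfl⟩ := Option.map_eq_some_iff.1 hx
      exact h2 y hy
    · exact (List.isChain_map _).2 h3
  · rintro ⟨⟨h1, h2, h3⟩, h4⟩
    refine ⟨fun x hx => h1 _ (List.mem_map_of_mem hx), fun x hx => h2 _ ?_,
      (List.isChain_map _).1 h3, h4⟩
    rw [List.getLast?_map, Option.mem_def.1 hx]
    rfl

theorem countP_tight (l : List OPart) :
    (l.countP fun y => y.1 % 4 = 0) = tightLength (l.map Prod.fst) := by
  rw [tightLength, List.countP_map]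
  rfl

/-- The forced overlines form a suffix, so the free flags form a prefix. Its length is the number of
parts not divisible by 4, though it may cover parts of any residue. -/
theorem bijOn_zipFlags : Set.BijOn zipFlags
    {p | IsPlain p.1 ∧ p.2.length = looseLength p.1} {l | IsFlagged l} := by
  refine ⟨?_, ?_, ?_⟩
  · rintro p ⟨h, hlen⟩
    refine (isFlagged_iff _).2 ⟨by rwa [map_fst_zipFlags hlen], ?_⟩
    rw [finalOverlined_iff, countP_tight, map_fst_zipFlags hlen, map_snd_zipFlags hlen]
    intro b hb
    rw [List.length_append, List.length_replicate, Nat.add_sub_cancel,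
      List.drop_left] at hb
    exact List.eq_of_mem_replicate hb
  · rintro p ⟨-, hp⟩ q ⟨-, hq⟩ he
    have h1 := congrArg (List.map Prod.fst) he
    have h2 := congrArg (List.map Prod.snd) he
    rw [map_fst_zipFlags hp, map_fst_zipFlags hq] at h1
    rw [map_snd_zipFlags hp, map_snd_zipFlags hq, h1] at h2
    exact Prod.ext h1 (List.append_cancel_right h2)
  · intro l hl
    obtain ⟨h1, h2⟩ := (isFlagged_iff l).1 hl
    have hlen : l.length - tightLength (l.map Prod.fst) = looseLength (l.map Prod.fst) := by
      have := looseLength_add_tightLength (l.map Prod.fst)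
      rw [List.length_map] at this
      omega
    have hle : looseLength (l.map Prod.fst) ≤ l.length := by omega
    refine ⟨(l.map Prod.fst, (l.map Prod.snd).take (looseLength (l.map Prod.fst))),
      ⟨h1, by simp [hle]⟩, ?_⟩
    have hd : (l.map Prod.snd).drop (looseLength (l.map Prod.fst)) =
        List.replicate (tightLength (l.map Prod.fst)) true := by
      rw [finalOverlined_iff, countP_tight, List.length_map, hlen] at h2
      refine List.eq_replicate_iff.2 ⟨?_, h2⟩
      rw [List.length_drop, List.length_map]
      have := looseLength_add_tightLength (l.map Prod.fst)
      rw [List.length_map] at this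
      omega
    rw [zipFlags, ← hd, List.take_append_drop]
    exact (List.zip_of_prod rfl rfl).symm

/-- The statistics of a plain list with flags. -/
def plainStat (p : List ℕ × List Bool) : ℕ × ℕ × ℕ :=
  (p.1.map partStat).sum + (4 * positionSum (p.2 ++ List.replicate (tightLength p.1) true), 0, 0)

theorem overStat_zipFlags {p : List ℕ × List Bool} (h : p.2.length = looseLength p.1) :
    overStat (raise (zipFlags p)) = plainStat p := by
  rw [overStat_raise, map_snd_zipFlags h, plainStat, overStat]
  conv_rhs => rw [← map_fst_zipFlags h, List.map_map]
  rw [map_fst_zipFlags h]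
  rfl

/-! ### From lists of keys to multisets -/

/-- A non-increasing list is determined by its multiset, and strictness after even entries means
that these do not repeat. This serves for keys and for codes. -/
theorem bijOn_coe : Set.BijOn (fun τ : List ℕ => (τ : Multiset ℕ)) {τ | τ.IsChain KeyLe}
    {M | ∀ k, k % 2 = 0 → M.count k ≤ 1} := by
  refine ⟨?_, ?_, ?_⟩
  · intro τ hτ k hk
    have hτ : τ.Pairwise KeyLe := List.isChain_iff_pairwise.1 hτ
    simp only [Multiset.coe_count]
    induction τ with
    | nil => simp
    | cons x τ ih =>
      obtain ⟨h1, h2⟩ := List.pairwise_cons.1 hτ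
      rw [List.count_cons]
      split_ifs with hx
      · have hx : x = k := by simpa using hx
        rw [List.count_eq_zero.2 fun hmem => ?_]
        have := h1 k hmem
        simp only [KeyLe] at this
        omega
      · exact ih (List.isChain_iff_pairwise.2 h2) h2
  · intro τ hτ τ' hτ' he
    refine List.Perm.eq_of_pairwise (fun a b _ _ h1 h2 => le_antisymm h2.1 h1.1)
      (List.isChain_iff_pairwise.1 hτ) (List.isChain_iff_pairwise.1 hτ') (Multiset.coe_eq_coe.1 he)
  · intro M hM
    refine ⟨M.sort (· ≥ ·), ?_, Multiset.sort_eq _ _⟩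
    refine List.isChain_iff_pairwise.2 ?_
    have hs := M.pairwise_sort (· ≥ ·)
    have hc : ∀ k, k % 2 = 0 → (M.sort (· ≥ ·)).count k ≤ 1 := fun k hk => by
      rw [← Multiset.coe_count, Multiset.sort_eq]
      exact hM k hk
    generalize M.sort (· ≥ ·) = τ at hs hc
    induction τ with
    | nil => simp
    | cons x τ ih =>
      obtain ⟨h1, h2⟩ := List.pairwise_cons.1 hs
      refine List.pairwise_cons.2 ⟨fun y hy => ⟨h1 y hy, fun hx => ?_⟩, ih h2 fun k hk =>
        (List.count_le_count_cons).trans (hc k hk)⟩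
      refine lt_of_le_of_ne (h1 y hy) ?_
      rintro rfl
      have := hc y hx
      rw [List.count_cons_self] at this
      have := List.count_pos_iff.2 hy
      omega

/-- The statistics of a key. -/
def keyStat (k : ℕ) : ℕ × ℕ × ℕ := ((partsOf k).map partStat).sum

theorem sum_partStat_expand (τ : List ℕ) :
    ((expand τ).map partStat).sum = (τ.map keyStat).sum := by
  induction τ with
  | nil => rfl
  | cons k τ ih => rw [expand_cons, List.map_append, List.sum_append, ih]; rfl

theorem looseLength_expand (τ : List ℕ) :
    looseLength (expand τ) = (τ.map fun k => looseLength (partsOf k)).sum := by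
  induction τ with
  | nil => rfl
  | cons k τ ih =>
    rw [expand_cons, List.map_cons, List.sum_cons, ← ih]
    simp [looseLength, List.countP_append]

theorem tightLength_expand (τ : List ℕ) :
    tightLength (expand τ) = τ.countP fun k => k % 4 = 3 := by
  induction τ with
  | nil => rfl
  | cons k τ ih =>
    rw [expand_cons, List.countP_cons, ← ih, add_comm]
    simp only [tightLength, List.countP_append, Nat.add_right_cancel_iff]
    unfold partsOf
    split_ifs <;> simp_all [List.countP_cons] <;> omega

/-- The number of parts not divisible by `4` encoded by the keys. -/
def keyLength (M : Multiset ℕ) : ℕ := (M.map fun k => looseLength (partsOf k)).sum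

/-- The multisets of keys of plain lists. -/
structure IsKeys (M : Multiset ℕ) : Prop where
  count_le : ∀ k, k % 2 = 0 → M.count k ≤ 1
  ne_zero : 0 ∉ M

/-- The statistics of a multiset of keys with flags. -/
def keysStat (p : Multiset ℕ × List Bool) : ℕ × ℕ × ℕ :=
  (p.1.map keyStat).sum +
    (4 * positionSum (p.2 ++ List.replicate (p.1.countP fun k => k % 4 = 3) true), 0, 0)

theorem ncard_plain (v : ℕ × ℕ × ℕ) :
    {p : Multiset ℕ × List Bool | (IsKeys p.1 ∧ p.2.length = keyLength p.1) ∧ keysStat p = v}.ncard =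
      {l | IsJagged l ∧ overStat l = v}.ncard := by
  have h1 := ncard_eq_of_bijOn (bijOn_raise.comp bijOn_zipFlags) plainStat overStat
    (fun p hp => overStat_zipFlags hp.2) v
  have h2 : Set.BijOn (Prod.map expand id)
      {p : List ℕ × List Bool | IsKeyList p.1 ∧ p.2.length = looseLength (expand p.1)}
      {p | IsPlain p.1 ∧ p.2.length = looseLength p.1} := by
    refine ⟨fun p hp => ⟨bijOn_expand.mapsTo hp.1, hp.2⟩, fun p hp q hq he => ?_, ?_⟩
    · exact Prod.ext (bijOn_expand.injOn hp.1 hq.1 (congrArg Prod.fst he)) (congrArg Prod.snd he :)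
    · rintro ⟨r, β⟩ ⟨hr, hβ⟩
      obtain ⟨τ, hτ, rfl⟩ := bijOn_expand.surjOn hr
      exact ⟨(τ, β), ⟨hτ, hβ⟩, rfl⟩
  have h3 : Set.BijOn (Prod.map (fun τ : List ℕ => (τ : Multiset ℕ)) id)
      {p : List ℕ × List Bool | IsKeyList p.1 ∧ p.2.length = looseLength (expand p.1)}
      {p : Multiset ℕ × List Bool | IsKeys p.1 ∧ p.2.length = keyLength p.1} := by
    refine ⟨fun p hp => ⟨⟨bijOn_coe.mapsTo hp.1.chain, by simpa using hp.1.ne_zero⟩, ?_⟩,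
      fun p hp q hq he => ?_, ?_⟩
    · simpa [keyLength, looseLength_expand] using hp.2
    · exact Prod.ext (bijOn_coe.injOn hp.1.chain hq.1.chain (congrArg Prod.fst he))
        (congrArg Prod.snd he :)
    · rintro ⟨M, β⟩ ⟨hM, hβ⟩
      obtain ⟨τ, hτ, rfl⟩ := bijOn_coe.surjOn hM.count_le
      exact ⟨(τ, β), ⟨⟨hτ, by simpa using hM.ne_zero⟩, by
        simpa [keyLength, looseLength_expand] using hβ⟩, rfl⟩
  have h4 := ncard_eq_of_bijOn h2 (plainStat ∘ Prod.map expand id) plainStat (fun _ _ => rfl) v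
  have h5 := ncard_eq_of_bijOn h3 (plainStat ∘ Prod.map expand id) keysStat (fun p _ => by
    simp [keysStat, plainStat, sum_partStat_expand, tightLength_expand]) v
  exact h5.symm.trans (h4.trans h1)

/-! ### Merging multiples of 4 and overline positions into one set -/

/-- The multisets of keys in which no key encodes a part divisible by `4`. -/
structure IsLooseKeys (M : Multiset ℕ) : Prop extends IsKeys M where
  mod_four : ∀ k ∈ M, k % 4 ≠ 3

/-- Add the keys encoding the parts `4 * m`, for `m` in the given list. -/
def insertTight (q : Multiset ℕ × List Bool × List ℕ) : Multiset ℕ × List Bool :=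
  (q.1 + (q.2.2 : Multiset ℕ).map fun m => 4 * m + 3, q.2.1)

theorem filter_add_map {M : Multiset ℕ} (hM : ∀ k ∈ M, k % 4 ≠ 3) (N : Multiset ℕ) :
    (M + N.map fun m => 4 * m + 3).filter (fun k => k % 4 ≠ 3) = M ∧
      (M + N.map fun m => 4 * m + 3).filter (fun k => k % 4 = 3) = N.map fun m => 4 * m + 3 := by
  have h : ∀ k ∈ N.map (fun m => 4 * m + 3), k % 4 = 3 := by
    intro k hk
    obtain ⟨m, -, rfl⟩ := Multiset.mem_map.1 hk
    omega
  rw [Multiset.filter_add, Multiset.filter_add, Multiset.filter_eq_self.2 hM,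
    Multiset.filter_eq_self.2 h, Multiset.filter_eq_nil.2 fun k hk => not_not.2 (h k hk),
    Multiset.filter_eq_nil.2 hM]
  simp

theorem keyLength_add_map (M N : Multiset ℕ) :
    keyLength (M + N.map fun m => 4 * m + 3) = keyLength M := by
  have : (N.map fun m => looseLength (partsOf (4 * m + 3))) = N.map fun _ => 0 := by
    refine Multiset.map_congr rfl fun m _ => ?_
    simp [partsOf, looseLength, show (4 * m + 3) % 4 = 3 by omega]
  simp [keyLength, this]

theorem isKeys_insertTight {M : Multiset ℕ} (hM : IsLooseKeys M) (N : Multiset ℕ) :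
    IsKeys (M + N.map fun m => 4 * m + 3) := by
  refine ⟨fun k hk => ?_, ?_⟩
  · rw [Multiset.count_add, Multiset.count_eq_zero (s := N.map _).2 fun h => ?_, add_zero]
    · exact hM.count_le k hk
    · obtain ⟨m, -, rfl⟩ := Multiset.mem_map.1 h
      omega
  · simp [hM.ne_zero]

theorem bijOn_insertTight : Set.BijOn insertTight
    {q | IsLooseKeys q.1 ∧ q.2.1.length = keyLength q.1 ∧ q.2.2.IsChain (· ≥ ·)}
    {p | IsKeys p.1 ∧ p.2.length = keyLength p.1} := by
  refine ⟨?_, ?_, ?_⟩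
  · rintro ⟨M, β, ν⟩ ⟨hM, hβ, -⟩
    exact ⟨isKeys_insertTight hM _, hβ.trans (keyLength_add_map _ _).symm⟩
  · rintro ⟨M, β, ν⟩ ⟨hM, hβ, hν⟩ ⟨M', β', ν'⟩ ⟨hM', hβ', hν'⟩ he
    have e1 := congrArg Prod.fst he
    have e2 : β = β' := congrArg Prod.snd he
    simp only [insertTight] at e1 hν hν'
    obtain ⟨f1, f2⟩ := filter_add_map hM.mod_four ν
    obtain ⟨f3, f4⟩ := filter_add_map hM'.mod_four ν'
    rw [e1] at f1 f2
    have e3 : M = M' := f1.symm.trans f3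
    have e4 := Multiset.map_injective (fun a b (h : 4 * a + 3 = 4 * b + 3) => by omega)
      (f2.symm.trans f4)
    have e5 : ν = ν' := List.Perm.eq_of_pairwise (fun a b _ _ h1 h2 => le_antisymm h2 h1)
      (List.isChain_iff_pairwise.1 hν) (List.isChain_iff_pairwise.1 hν') (Multiset.coe_eq_coe.1 e4)
    rw [e2, e3, e5]
  · rintro ⟨M, β⟩ ⟨hM, hβ⟩
    have hN : (((M.filter fun k => k % 4 = 3).map fun k => k / 4).map fun m => 4 * m + 3) =
        M.filter fun k => k % 4 = 3 := by
      rw [Multiset.map_map]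
      refine (Multiset.map_congr rfl fun k hk => ?_).trans (Multiset.map_id _)
      have := (Multiset.mem_filter.1 hk).2
      simp only [Function.comp_apply, id]
      omega
    have hadd : (M.filter fun k => k % 4 ≠ 3) +
        (((M.filter fun k => k % 4 = 3).map fun k => k / 4).map fun m => 4 * m + 3) = M := by
      rw [hN, add_comm]
      exact Multiset.filter_add_not _ _
    refine ⟨(M.filter fun k => k % 4 ≠ 3, β,
      ((M.filter fun k => k % 4 = 3).map fun k => k / 4).sort (· ≥ ·)), ⟨⟨⟨fun k hk => ?_, ?_⟩, ?_⟩,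
      ?_, ?_⟩, ?_⟩
    · exact (Multiset.count_le_of_le k (Multiset.filter_le _ _)).trans (hM.count_le k hk)
    · exact fun h => hM.ne_zero (Multiset.mem_of_mem_filter h)
    · exact fun k hk => (Multiset.mem_filter.1 hk).2
    · refine Eq.trans hβ ?_
      conv_lhs => rw [← hadd]
      exact keyLength_add_map _ _
    · exact List.isChain_iff_pairwise.2 (Multiset.pairwise_sort _ _)
    · simp only [insertTight, Multiset.sort_eq, hadd]

/-- Make a non-increasing list strictly decreasing with all entries greater than `s`. -/
def stair (s : ℕ) : List ℕ → List ℕ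
  | [] => []
  | x :: l => (x + s + l.length + 1) :: stair s l

/-- The inverse of `stair`. -/
def unstair (s : ℕ) : List ℕ → List ℕ
  | [] => []
  | x :: l => (x - s - l.length - 1) :: unstair s l

@[simp] theorem length_stair (s : ℕ) (l : List ℕ) : (stair s l).length = l.length := by
  induction l with
  | nil => rfl
  | cons x l ih => simp [stair, ih]

@[simp] theorem length_unstair (s : ℕ) (l : List ℕ) : (unstair s l).length = l.length := by
  induction l with
  | nil => rfl
  | cons x l ih => simp [unstair, ih]

theorem unstair_stair (s : ℕ) (l : List ℕ) : unstair s (stair s l) = l := by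
  induction l with
  | nil => rfl
  | cons x l ih =>
    simp only [stair, unstair, ih, length_stair, List.cons.injEq, and_true]
    omega

theorem lt_of_mem_stair {s : ℕ} {l : List ℕ} : ∀ x ∈ stair s l, s < x := by
  induction l with
  | nil => simp [stair]
  | cons x l ih =>
    intro y hy
    rcases List.mem_cons.1 hy with rfl | hy
    · omega
    · exact ih y hy

theorem isChain_stair (s : ℕ) (l : List ℕ) :
    (stair s l).IsChain (· > ·) ↔ l.IsChain (· ≥ ·) := by
  induction l with
  | nil => simp [stair]
  | cons x l ih =>
    cases l with
    | nil => simp [stair]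
    | cons y l =>
      have h : stair s (x :: y :: l) =
        (x + s + (y :: l).length + 1) :: (y + s + l.length + 1) :: stair s l := rfl
      rw [h, List.isChain_cons_cons, List.isChain_cons_cons, ← ih]
      refine and_congr ?_ Iff.rfl
      simp only [List.length_cons]
      omega

theorem stair_unstair {s : ℕ} {l : List ℕ} (h : l.IsChain (· > ·)) (hs : ∀ x ∈ l, s < x) :
    stair s (unstair s l) = l := by
  induction l with
  | nil => rfl
  | cons x l ih =>
    -- Strict decrease above s makes the subtraction in `unstair` exact.
    have hx : s + l.length < x := by
      clear ih
      induction l generalizing x with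
      | nil => simpa using hs
      | cons y l ih =>
        rw [List.isChain_cons_cons] at h
        have := ih y h.2 fun z hz => hs z (by simp [hz])
        simp only [List.length_cons]
        have := h.1
        omega
    simp only [unstair, stair, ih (List.isChain_cons.1 h).2 fun z hz => hs z (by simp [hz]),
      length_unstair, List.cons.injEq, and_true]
    omega

/-- The added numbers are the positions of the forced overlines, as in
`positionSum_append_replicate`. -/
theorem sum_stair (s : ℕ) (l : List ℕ) :
    (stair s l).sum = l.sum + ∑ i ∈ Finset.range l.length, (s + i + 1) := by
  induction l with
  | nil => rfl
  | cons x l ih =>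
    simp only [stair, List.sum_cons, ih, List.length_cons, Finset.sum_range_succ]
    omega

/-- The flags telling which of `1, …, s` lie in `T`. -/
def flags (s : ℕ) (T : Finset ℕ) : List Bool := (List.range s).map fun k => decide (k + 1 ∈ T)

/-- The elements of `T` greater than `s`, in decreasing order. -/
def above (s : ℕ) (T : Finset ℕ) : List ℕ := (T.filter fun k => s < k).sort (· ≥ ·)

theorem mem_above {s k : ℕ} {T : Finset ℕ} : k ∈ above s T ↔ k ∈ T ∧ s < k := by
  simp [above]

theorem isChain_above (s : ℕ) (T : Finset ℕ) : (above s T).IsChain (· > ·) := by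
  refine List.isChain_iff_pairwise.2 ?_
  have h1 : (above s T).Pairwise (· ≥ ·) := Finset.pairwise_sort _ _
  have h2 : (above s T).Nodup := Finset.sort_nodup _ _
  exact (h1.and h2).imp fun h => lt_of_le_of_ne h.1 (Ne.symm h.2)

theorem sum_above (s : ℕ) (T : Finset ℕ) : (above s T).sum = ∑ k ∈ T with s < k, k := by
  rw [Finset.sum_eq_multiset_sum, Multiset.map_id', ← Finset.sort_eq _ (· ≥ ·), Multiset.sum_coe]
  rfl

theorem positionSum_flags (s : ℕ) (T : Finset ℕ) :
    positionSum (flags s T) = ∑ k ∈ T with ¬ s < k, k := by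
  induction s with
  | zero =>
    symm
    refine Finset.sum_eq_zero fun k hk => ?_
    have := (Finset.mem_filter.1 hk).2
    omega
  | succ s ih =>
    rw [flags, List.range_succ, List.map_append, List.map_singleton, positionSum_append, ← flags, ih]
    simp only [Finset.sum_filter, flags, List.length_map, List.length_range, decide_eq_true_eq]
    -- The contribution of s+1 is rewritten as a sum over `T`, for a termwise comparison.
    rw [← Finset.sum_ite_eq' T (s + 1) fun k => k, ← Finset.sum_add_distrib]
    refine Finset.sum_congr rfl fun k _ => ?_
    split_ifs <;> omega

theorem splitSet_inj {s : ℕ} {T T' : Finset ℕ} (h0 : 0 ∉ T) (h0' : 0 ∉ T')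
    (h1 : flags s T = flags s T') (h2 : above s T = above s T') : T = T' := by
  ext k
  rcases lt_or_ge s k with h | h
  · have := mem_above (s := s) (k := k) (T := T)
    rw [h2, mem_above] at this
    tauto
  · rcases Nat.eq_zero_or_pos k with rfl | hk
    · simp [h0, h0']
    · have h3 := congrArg (fun l => l[k - 1]?) h1
      simp only [flags, List.getElem?_map, List.getElem?_range (show k - 1 < s by omega),
        Option.map_some, Option.some.injEq, decide_eq_decide] at h3
      rwa [Nat.sub_add_cancel hk] at h3

theorem splitSet_surj {s : ℕ} {β : List Bool} {V : List ℕ} (hβ : β.length = s)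
    (hV : V.IsChain (· > ·)) (hs : ∀ k ∈ V, s < k) :
    ∃ T : Finset ℕ, 0 ∉ T ∧ flags s T = β ∧ above s T = V := by
  -- The flag at index k stands for the integer k+1.
  refine ⟨((Finset.range s).filter fun k => β[k]? = some true).image (· + 1) ∪ V.toFinset,
    ?_, ?_, ?_⟩
  · simp only [Finset.mem_union, Finset.mem_image, List.mem_toFinset, not_or]
    exact ⟨by simp, fun h => absurd (hs 0 h) (by omega)⟩
  · refine List.ext_getElem (by simp [flags, hβ]) fun k hk hk' => ?_
    have h : k + 1 ∉ V := fun h => by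
      have := hs _ h
      omega
    simp [flags, h, hk', ← hβ]
  · have hnd : V.Pairwise (· > ·) := List.isChain_iff_pairwise.1 hV
    refine List.Perm.eq_of_pairwise (le := (· > ·)) (fun a b _ _ h1 h2 => absurd h1 (lt_asymm h2))
      (List.isChain_iff_pairwise.1 (isChain_above _ _)) hnd ?_
    refine (List.perm_ext_iff_of_nodup (Finset.sort_nodup _ _) (hnd.imp fun h => ne_of_gt h)).2
      fun k => ?_
    change k ∈ above _ _ ↔ _
    rw [mem_above]
    simp only [Finset.mem_union, Finset.mem_image, Finset.mem_filter, Finset.mem_range,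
      List.mem_toFinset]
    constructor
    · rintro ⟨⟨a, ⟨ha, -⟩, rfl⟩ | h, h'⟩
      · omega
      · exact h
    · exact fun h => ⟨Or.inr h, hs k h⟩

/-- Turn a set of positive integers into flags and a non-increasing list. -/
def splitSet (p : Multiset ℕ × Finset ℕ) : Multiset ℕ × List Bool × List ℕ :=
  (p.1, flags (keyLength p.1) p.2, unstair (keyLength p.1) (above (keyLength p.1) p.2))

theorem bijOn_splitSet : Set.BijOn splitSet {p | IsLooseKeys p.1 ∧ 0 ∉ p.2}
    {q | IsLooseKeys q.1 ∧ q.2.1.length = keyLength q.1 ∧ q.2.2.IsChain (· ≥ ·)} := by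
  have hst : ∀ s T, stair s (unstair s (above s T)) = above s T := fun s T =>
    stair_unstair (isChain_above s T) fun k hk => (mem_above.1 hk).2
  refine ⟨?_, ?_, ?_⟩
  · rintro ⟨M, T⟩ ⟨hM, -⟩
    refine ⟨hM, by simp [splitSet, flags], ?_⟩
    rw [← isChain_stair (keyLength M)]
    simp only [splitSet]
    rw [hst]
    exact isChain_above _ _
  · rintro ⟨M, T⟩ ⟨hM, h0⟩ ⟨M', T'⟩ ⟨hM', h0'⟩ he
    simp only [splitSet, Prod.mk.injEq] at he
    obtain ⟨rfl, h1, h2⟩ := he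
    have h3 := congrArg (stair (keyLength M)) h2
    rw [hst, hst] at h3
    exact congrArg (Prod.mk M) (splitSet_inj h0 h0' h1 h3)
  · rintro ⟨M, β, ν⟩ ⟨hM, hβ, hν⟩
    obtain ⟨T, h0, h1, h2⟩ := splitSet_surj hβ ((isChain_stair (keyLength M) ν).2 hν) lt_of_mem_stair
    exact ⟨(M, T), ⟨hM, h0⟩, by simp only [splitSet, h1, h2, unstair_stair]⟩

/-- The statistics of a multiset of keys with a set of integers. -/
def setStat (p : Multiset ℕ × Finset ℕ) : ℕ × ℕ × ℕ :=
  (p.1.map keyStat).sum + (4 * ∑ k ∈ p.2, k, 0, 0)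

theorem sum_keyStat_map (N : Multiset ℕ) :
    ((N.map fun m => 4 * m + 3).map keyStat).sum = (4 * N.sum, 0, 0) := by
  induction N using Multiset.induction_on with
  | empty => rfl
  | cons m N ih =>
    rw [Multiset.map_cons, Multiset.map_cons, Multiset.sum_cons, ih, Multiset.sum_cons]
    simp [keyStat, partsOf, partStat, show (4 * m + 3) % 4 = 3 by omega, mul_add]

theorem keysStat_insertTight_splitSet {p : Multiset ℕ × Finset ℕ} (hM : IsLooseKeys p.1)
    (h0 : 0 ∉ p.2) : keysStat (insertTight (splitSet p)) = setStat p := by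
  obtain ⟨M, T⟩ := p
  obtain ⟨q1, q2, q3⟩ := bijOn_splitSet.mapsTo (show (M, T) ∈ _ from ⟨hM, h0⟩)
  have hsum := sum_stair (keyLength M) (splitSet (M, T)).2.2
  rw [show stair (keyLength M) (splitSet (M, T)).2.2 = above (keyLength M) T from
    stair_unstair (isChain_above _ T) fun k hk => (mem_above.1 hk).2, sum_above] at hsum
  have hpos := positionSum_flags (keyLength M) T
  have htot := Finset.sum_filter_add_sum_filter_not T (fun k => keyLength M < k) fun k => k
  have hcount : (insertTight (splitSet (M, T))).1.countP (fun k => k % 4 = 3) =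
      (splitSet (M, T)).2.2.length := by
    rw [Multiset.countP_eq_card_filter]
    refine (congrArg Multiset.card (filter_add_map hM.mod_four _).2).trans ?_
    simp
  have hlen : (splitSet (M, T)).2.1.length = keyLength M := q2
  rw [keysStat, hcount, setStat]
  simp only [insertTight, Multiset.map_add, Multiset.sum_add, sum_keyStat_map]
  -- The cost of the forced overlines is exactly what `stair` adds to the list.
  rw [positionSum_append_replicate, hlen, add_assoc]
  refine congrArg₂ _ rfl ?_
  rw [Prod.mk_add_mk, Multiset.sum_coe]
  change positionSum (splitSet (M, T)).2.1 = _ at hpos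
  ext
  · simp only
    omega
  · rfl
  · rfl

theorem ncard_sets (v : ℕ × ℕ × ℕ) :
    {p : Multiset ℕ × Finset ℕ | (IsLooseKeys p.1 ∧ 0 ∉ p.2) ∧ setStat p = v}.ncard =
      {l | IsJagged l ∧ overStat l = v}.ncard :=
  (ncard_eq_of_bijOn (bijOn_insertTight.comp bijOn_splitSet) setStat keysStat
    (fun _ hp => keysStat_insertTight_splitSet hp.1 hp.2) v).trans (ncard_plain v)

/-! ### Codes of overpartitions -/

/-- The code of a part of an overpartition. -/
def code (x : OPart) : ℕ := 2 * x.1 + if x.2 then 0 else 1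

/-- The part of an overpartition with given code. -/
def decode (d : ℕ) : OPart := (d / 2, decide (d % 2 = 0))

theorem decode_code (x : OPart) : decode (code x) = x := by
  obtain ⟨a, b⟩ := x
  cases b <;> simp [code, decode] <;> omega

theorem code_decode (d : ℕ) : code (decode d) = d := by
  simp only [code, decode, decide_eq_true_eq]
  split_ifs <;> omega

/-- The codes of the parts of restricted overpartitions. -/
def IsCode (d : ℕ) : Prop :=
  (d % 8 = 0 ∧ d ≠ 0) ∨ (d % 8 = 2 ∧ d ≠ 2) ∨ d % 8 = 4 ∨ d % 16 = 7

/-- Overlined parts have even codes, and at equal size the non-overlined part has the larger code.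
So `KeyLe` on codes is the non-increasing order with overlines on final occurrences only. -/
theorem isRestrictedOver_iff (l : List OPart) :
    IsRestrictedOver l ↔ (l.map code).IsChain KeyLe ∧ ∀ d ∈ l.map code, IsCode d := by
  have hpair : (l.map code).IsChain KeyLe ↔
      (l.Pairwise fun x y => y.size ≤ x.size) ∧ OnlyFinalOverlined l := by
    rw [List.isChain_iff_pairwise, List.pairwise_map, OnlyFinalOverlined, ← List.pairwise_and_iff]
    have h : ∀ x y : OPart, KeyLe (code x) (code y) ↔
        y.size ≤ x.size ∧ (x.IsOverlined → y.size ≠ x.size) := by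
      rintro ⟨a, b⟩ ⟨c, d⟩
      cases b <;> cases d <;> simp [code, KeyLe, OPart.size, OPart.IsOverlined] <;> omega
    exact ⟨fun H => H.imp fun {x y} hxy => (h x y).1 hxy,
      fun H => H.imp fun {x y} hxy => (h x y).2 hxy⟩
  rw [hpair]
  constructor
  · rintro ⟨⟨h1, h2, h3⟩, h4, h5, h6⟩
    refine ⟨⟨h2, h3⟩, fun d hd => ?_⟩
    obtain ⟨⟨a, b⟩, hx, rfl⟩ := List.mem_map.1 hd
    have h1 := h1 _ hx
    have h4 := h4 _ hx
    have h6 := h6 _ hx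
    cases b
    · simp [code, IsCode, OPart.size, OPart.IsOverlined] at h1 h6 ⊢
      omega
    · have : a ≠ 1 := by
        rintro rfl
        exact h5 hx
      simp [code, IsCode, OPart.size, OPart.IsOverlined] at h1 h4 ⊢
      omega
  · rintro ⟨⟨h2, h3⟩, h⟩
    have key : ∀ x ∈ l, IsCode (code x) := fun x hx => h _ (List.mem_map_of_mem hx)
    refine ⟨⟨fun x hx => ?_, h2, h3⟩, fun x hx ho => ?_, fun hx => ?_, fun x hx ho => ?_⟩
    · have := key x hx
      obtain ⟨a, b⟩ := x
      cases b <;> simp [code, IsCode, OPart.size] at this ⊢ <;> omega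
    · have := key x hx
      obtain ⟨a, b⟩ := x
      cases b <;> simp [code, IsCode, OPart.size, OPart.IsOverlined] at this ho ⊢
      omega
    · have := key _ hx
      simp [code, IsCode] at this
    · have := key x hx
      obtain ⟨a, b⟩ := x
      cases b <;> simp [code, IsCode, OPart.size, OPart.IsOverlined] at this ho ⊢
      omega

/-- The statistics of the part with given code. -/
def codeStat (d : ℕ) : ℕ × ℕ × ℕ :=
  (d / 2, if d / 2 % 4 = 1 ∨ d / 2 % 8 = 3 then 1 else 0,
    if d / 2 % 4 = 2 ∨ d / 2 % 8 = 3 then 1 else 0)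

/-- The statistics of an overpartition. -/
def restrictedStat (l : List OPart) : ℕ × ℕ × ℕ :=
  (weight l, (l.countP fun x => x.size % 4 = 1 ∨ x.size % 8 = 3),
    l.countP fun x => x.size % 4 = 2 ∨ x.size % 8 = 3)

theorem restrictedStat_eq (l : List OPart) :
    restrictedStat l = ((l.map code).map codeStat).sum := by
  induction l with
  | nil => rfl
  | cons x l ih =>
    rw [List.map_cons, List.map_cons, List.sum_cons, ← ih]
    have : code x / 2 = x.1 := by simp only [code]; split_ifs <;> omega
    simp [restrictedStat, weight, codeStat, this, List.countP_cons, add_comm]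

/-- The multisets of codes of restricted overpartitions. -/
structure IsCodes (C : Multiset ℕ) : Prop where
  count_le : ∀ d, d % 2 = 0 → C.count d ≤ 1
  isCode : ∀ d ∈ C, IsCode d

theorem ncard_codes (v : ℕ × ℕ × ℕ) :
    {C : Multiset ℕ | IsCodes C ∧ (C.map codeStat).sum = v}.ncard =
      {l | IsRestrictedOver l ∧ restrictedStat l = v}.ncard := by
  symm
  refine ncard_eq_of_bijOn (A := {l | IsRestrictedOver l}) (B := {C | IsCodes C})
    (f := fun l => (l.map code : Multiset ℕ)) ⟨?_, ?_, ?_⟩ restrictedStat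
    (fun C => (C.map codeStat).sum) ?_ v
  · intro l hl
    obtain ⟨h1, h2⟩ := (isRestrictedOver_iff l).1 hl
    exact ⟨bijOn_coe.mapsTo h1, fun d hd => h2 d (Multiset.mem_coe.1 hd)⟩
  · intro l hl l' hl' he
    exact List.map_injective_iff.2 (Function.LeftInverse.injective decode_code)
      (bijOn_coe.injOn ((isRestrictedOver_iff l).1 hl).1 ((isRestrictedOver_iff l').1 hl').1 he)
  · intro C hC
    obtain ⟨τ, hτ, rfl⟩ := bijOn_coe.surjOn hC.count_le
    have h : (τ.map decode).map code = τ := by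
      rw [List.map_map]
      exact (List.map_congr_left fun d _ => code_decode d).trans (List.map_id _)
    refine ⟨τ.map decode, (isRestrictedOver_iff _).2 ?_, by simp only [h]⟩
    rw [h]
    exact ⟨hτ, fun d hd => hC.isCode d (Multiset.mem_coe.2 hd)⟩
  · intro l _
    rw [restrictedStat_eq, Multiset.map_coe, Multiset.sum_coe]

/-! ### Matching keys with codes -/

/-- The code of the part of a restricted overpartition corresponding to a key. -/
def keyCode (k : ℕ) : ℕ := if k % 4 = 0 then 2 * k + 2 else if k % 4 = 2 then 2 * k else 4 * k + 3

/-- Keys congruent to 3 modulo 4 are never translated; their values, 15 modulo 16, only make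
injectivity unconditional. -/
theorem keyCode_injective : Function.Injective keyCode := by
  intro a b h
  unfold keyCode at h
  split_ifs at h <;> omega

/-- The codes corresponding to keys and a set of integers. -/
def codes (p : Multiset ℕ × Finset ℕ) : Multiset ℕ :=
  p.1.map keyCode + p.2.val.map fun k => 8 * k

theorem filter_codes {M : Multiset ℕ} (hM : ∀ k ∈ M, k % 4 ≠ 3) (T : Finset ℕ) :
    (codes (M, T)).filter (fun d => d % 8 ≠ 0) = M.map keyCode ∧
      (codes (M, T)).filter (fun d => d % 8 = 0) = T.val.map fun k => 8 * k := by
  have h1 : ∀ d ∈ M.map keyCode, d % 8 ≠ 0 := by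
    intro d hd
    obtain ⟨k, hk, rfl⟩ := Multiset.mem_map.1 hd
    have := hM k hk
    unfold keyCode
    split_ifs <;> omega
  have h2 : ∀ d ∈ T.val.map (fun k => 8 * k), d % 8 = 0 := by
    intro d hd
    obtain ⟨k, -, rfl⟩ := Multiset.mem_map.1 hd
    omega
  rw [codes, Multiset.filter_add, Multiset.filter_add, Multiset.filter_eq_self.2 h1,
    Multiset.filter_eq_self.2 h2, Multiset.filter_eq_nil.2 fun k hk => not_not.2 (h2 k hk),
    Multiset.filter_eq_nil.2 h1]
  simp

theorem isCodes_codes {M : Multiset ℕ} {T : Finset ℕ} (hM : IsLooseKeys M) (h0 : 0 ∉ T) :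
    IsCodes (codes (M, T)) := by
  obtain ⟨f1, f2⟩ := filter_codes hM.mod_four T
  refine ⟨fun d hd => ?_, fun d hd => ?_⟩
  · by_cases h8 : d % 8 = 0
    · rw [← Multiset.count_filter_of_pos (p := fun d => d % 8 = 0) h8, f2]
      refine Multiset.nodup_iff_count_le_one.1 ?_ d
      exact T.nodup.map fun a b (h : 8 * a = 8 * b) => by omega
    · rw [← Multiset.count_filter_of_pos (p := fun d => d % 8 ≠ 0) h8, f1]
      by_cases hmem : d ∈ M.map keyCode
      · obtain ⟨k, hk, rfl⟩ := Multiset.mem_map.1 hmem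
        rw [Multiset.count_map_eq_count' _ _ keyCode_injective]
        refine hM.count_le k ?_
        unfold keyCode at hd
        split_ifs at hd <;> omega
      · simp [Multiset.count_eq_zero.2 hmem]
  · rcases Multiset.mem_add.1 hd with hd | hd
    · obtain ⟨k, hk, rfl⟩ := Multiset.mem_map.1 hd
      have h1 := hM.mod_four k hk
      have h2 : k ≠ 0 := by
        rintro rfl
        exact hM.ne_zero hk
      unfold keyCode IsCode
      split_ifs <;> omega
    · obtain ⟨k, hk, rfl⟩ := Multiset.mem_map.1 hd
      have : k ≠ 0 := by
        rintro rfl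
        exact h0 hk
      unfold IsCode
      omega

/-- The parity clause carries the bound on multiplicities from codes back to keys. -/
theorem exists_keyCode {d : ℕ} (h : IsCode d) (h8 : d % 8 ≠ 0) :
    ∃ k, keyCode k = d ∧ k ≠ 0 ∧ k % 4 ≠ 3 ∧ (k % 2 = 0 → d % 2 = 0) := by
  unfold IsCode at h
  have h' : (d % 8 = 2 ∧ d ≠ 2) ∨ d % 8 = 4 ∨ d % 16 = 7 := by tauto
  unfold keyCode
  rcases h' with h' | h' | h'
  · refine ⟨(d - 2) / 2, ?_, ?_⟩
    · rw [if_pos (by omega)]; omega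
    · omega
  · refine ⟨d / 2, ?_, ?_⟩
    · rw [if_neg (by omega), if_pos (by omega)]; omega
    · omega
  · refine ⟨(d - 3) / 4, ?_, ?_⟩
    · rw [if_neg (by omega), if_neg (by omega)]; omega
    · omega

theorem exists_codes_eq {C : Multiset ℕ} (hC : IsCodes C) :
    ∃ p : Multiset ℕ × Finset ℕ, (IsLooseKeys p.1 ∧ 0 ∉ p.2) ∧ codes p = C := by
  have hex : ∀ d ∈ C.filter (fun d => d % 8 ≠ 0), ∃ k, keyCode k = d := fun d hd =>
    (exists_keyCode (hC.isCode d (Multiset.mem_of_mem_filter hd)) (Multiset.mem_filter.1 hd).2).imp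
      fun k hk => hk.1
  obtain ⟨M, hM⟩ : ∃ M : Multiset ℕ, M.map keyCode = C.filter fun d => d % 8 ≠ 0 := by
    refine ⟨(C.filter fun d => d % 8 ≠ 0).map (Function.invFun keyCode), ?_⟩
    rw [Multiset.map_map]
    refine (Multiset.map_congr rfl fun d hd => ?_).trans (Multiset.map_id _)
    exact Function.invFun_eq (hex d hd)
  have hT : ((C.filter fun d => d % 8 = 0).map fun d => d / 8).map (fun k => 8 * k) =
      C.filter fun d => d % 8 = 0 := by
    rw [Multiset.map_map]
    refine (Multiset.map_congr rfl fun d hd => ?_).trans (Multiset.map_id _)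
    have := (Multiset.mem_filter.1 hd).2
    simp only [Function.comp_apply, id]
    omega
  have hnd : ((C.filter fun d => d % 8 = 0).map fun d => d / 8).Nodup := by
    refine Multiset.Nodup.of_map (fun k => 8 * k) ?_
    rw [hT, Multiset.nodup_iff_count_le_one]
    intro d
    by_cases hd : d % 8 = 0
    · rw [Multiset.count_filter_of_pos (p := fun d => d % 8 = 0) hd]
      exact hC.count_le d (by omega)
    · rw [Multiset.count_filter_of_neg (p := fun d => d % 8 = 0) hd]
      omega
  have hmem : ∀ k ∈ M, k ≠ 0 ∧ k % 4 ≠ 3 ∧ (k % 2 = 0 → keyCode k % 2 = 0) := by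
    intro k hk
    have h := Multiset.mem_map_of_mem keyCode hk
    rw [hM] at h
    obtain ⟨k', hk', h'⟩ := exists_keyCode (hC.isCode _ (Multiset.mem_of_mem_filter h))
      (Multiset.mem_filter.1 h).2
    rw [← keyCode_injective hk']
    rw [hk']
    exact h'
  refine ⟨(M, ⟨_, hnd⟩), ⟨⟨⟨fun k hk => ?_, fun h => (hmem 0 h).1 rfl⟩, fun k hk => (hmem k hk).2.1⟩,
    ?_⟩, ?_⟩
  · by_cases hkM : k ∈ M
    · rw [← Multiset.count_map_eq_count' keyCode M keyCode_injective, hM]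
      exact (Multiset.count_le_of_le _ (Multiset.filter_le _ _)).trans
        (hC.count_le _ ((hmem k hkM).2.2 hk))
    · simp [Multiset.count_eq_zero.2 hkM]
  · intro h
    obtain ⟨d, hd, hd0⟩ := Multiset.mem_map.1 (Finset.mem_def.1 h)
    obtain ⟨h1, h2⟩ := Multiset.mem_filter.1 hd
    have := hC.isCode d h1
    unfold IsCode at this
    omega
  · rw [codes, hM, hT, add_comm]
    exact Multiset.filter_add_not _ _

theorem bijOn_codes : Set.BijOn codes {p | IsLooseKeys p.1 ∧ 0 ∉ p.2} {C | IsCodes C} := by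
  refine ⟨fun p hp => isCodes_codes hp.1 hp.2, ?_, fun C hC => exists_codes_eq hC⟩
  rintro ⟨M, T⟩ ⟨hM, -⟩ ⟨M', T'⟩ ⟨hM', -⟩ he
  obtain ⟨f1, f2⟩ := filter_codes hM.mod_four T
  obtain ⟨f3, f4⟩ := filter_codes hM'.mod_four T'
  rw [he] at f1 f2
  have h1 := Multiset.map_injective keyCode_injective (f1.symm.trans f3)
  have h2 := Multiset.map_injective (fun a b (h : 8 * a = 8 * b) => by omega) (f2.symm.trans f4)
  exact Prod.ext h1 (Finset.val_injective h2)

/-- For k = 4m+1, the pair 4m+1, 4m+2 and the single part 8m+3 have equal weight and add one to each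
count. -/
theorem codeStat_keyCode {k : ℕ} (hk : k % 4 ≠ 3) : codeStat (keyCode k) = keyStat k := by
  have h : k % 4 = 0 ∨ k % 4 = 1 ∨ k % 4 = 2 := by omega
  rcases h with h | h | h
  · have h1 : (k + 1) % 4 = 1 := by omega
    have h2 : (k + 1) % 8 ≠ 3 := by omega
    simp [keyCode, keyStat, codeStat, partsOf, partStat, h, show (2 * k + 2) / 2 = k + 1 by omega,
      h1, h2]
  · have h1 : (4 * k + 3) / 2 = k + (k + 1) := by omega
    have h2 : (k + (k + 1)) % 8 = 3 := by omega
    have h3 : (k + 1) % 4 = 2 := by omega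
    simp [keyCode, keyStat, codeStat, partsOf, partStat, h, h1, h2, h3]
  · have h1 : k % 8 ≠ 3 := by omega
    simp [keyCode, keyStat, codeStat, partsOf, partStat, h, h1]

theorem sum_codeStat_codes {p : Multiset ℕ × Finset ℕ} (hM : ∀ k ∈ p.1, k % 4 ≠ 3) :
    ((codes p).map codeStat).sum = setStat p := by
  rw [codes, Multiset.map_add, Multiset.sum_add, setStat, Multiset.map_map, Multiset.map_map]
  refine congrArg₂ _ (congrArg _ (Multiset.map_congr rfl fun k hk => codeStat_keyCode (hM k hk))) ?_
  rw [Finset.sum_eq_multiset_sum, Multiset.map_id']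
  generalize p.2.val = N
  induction N using Multiset.induction_on with
  | empty => rfl
  | cons k N ih =>
    rw [Multiset.map_cons, Multiset.sum_cons, ih, Multiset.sum_cons]
    have h : 8 * k / 2 = 4 * k := by omega
    have h1 : 4 * k % 8 ≠ 3 := by omega
    simp [codeStat, h, h1, mul_add]

theorem ncard_jagged_eq (v : ℕ × ℕ × ℕ) :
    {l | IsJagged l ∧ overStat l = v}.ncard =
      {l | IsRestrictedOver l ∧ restrictedStat l = v}.ncard :=
  (ncard_sets v).symm.trans ((ncard_eq_of_bijOn bijOn_codes setStat
    (fun C => (C.map codeStat).sum) (fun _ hp => sum_codeStat_codes hp.1.mod_four) v).trans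
    (ncard_codes v))

end JaggedOverpartition

theorem mainTheorem9 (n i j : ℕ) : jaggedCount n i j = restrictedOverCount n i j := by
  have h := JaggedOverpartition.ncard_jagged_eq (n, i, j)
  simpa only [jaggedCount, jaggedSet, restrictedOverCount, restrictedOverSet,
    JaggedOverpartition.overStat_eq, JaggedOverpartition.restrictedStat,
    Prod.mk.injEq] using h
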